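/- All spaces are real. For a normed space $X$, a functional $x^*\in X^*$ is norm-attaining if there is $x_0\in X$ with $\|x_0\|=1$ and $|x^*(x_0)|=\|x^*\|$. For a Banach space $E$ and a positively homogeneous function $f\colon E^*\to\mathbb R$ (that is, $f(\lambda x^*)=\lambda f(x^*)$ for $\lambda\ge 0$), put $$\|f\|_{FBL[E]}=\sup\Big\{\sum_{i=1}^n|f(x_i^*)| : n\in\mathbb N,\ x_1^*,\dots,x_n^*\in E^*,\ \sup_{\|x\|\le 1}\sum_{i=1}^n|x_i^*(x)|\le 1\Big\}.$$ The free Banach lattice $FBL[E]$ is the smallest closed vector sublattice, containing all evaluations $\delta_x\colon x^*\mapsto x^*(x)$ ($x\in E$), of the Banach lattice of positively homogeneous functions on $E^*$ with finite norm $\|\cdot\|_{FBL[E]}$ (pointwise order and operations). For $x^*\in E^*$, let $\delta_{x^*}\in FBL[E]^*$ be the lattice homomorphism $\delta_{x^*}(f)=f(x^*)$. Say that $E$ satisfies $(\ast)$ if for every $x^*\in E^*$: $x^*$ is norm-attaining on $E$ if and only if $\delta_{x^*}$ is norm-attaining on $FBL[E]$. A subspace $Z\subseteq E$ is an almost isometric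 ideal in $E$ if for every $\varepsilon>0$ and every finite-dimensional subspace $F\subseteq E$ there is a linear operator $T\colon F\to Z$ with $T(x)=x$ for all $x\in F\cap Z$ and $(1-\varepsilon)\|x\|\le\|T(x)\|\le(1+\varepsilon)\|x\|$ for all $x\in F$. **Theorem.** Let $E$ be a Banach space that does not satisfy $(\ast)$. Then there is a closed separable almost isometric ideal $Z$ in $E$ such that the Banach space $Z$ does not satisfy $(\ast)$. Consequently, if every separable Banach space satisfies $(\ast)$, then every Banach space satisfies $(\ast)$. -/

import Mathlib

noncomputable section

/-- A bounded linear functional on a real normed space attains its norm if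
`|φ x| = ‖φ‖` for some `x` in the unit sphere. -/
def IsNormAttaining {X : Type*} [NormedAddCommGroup X] [NormedSpace ℝ X]
    (φ : StrongDual ℝ X) : Prop :=
  ∃ x : X, ‖x‖ = 1 ∧ |φ x| = ‖φ‖

/-- `Z` is an almost isometric ideal in `E`. -/
def IsAlmostIsometricIdeal {E : Type*} [NormedAddCommGroup E] [NormedSpace ℝ E]
    (Z : Submodule ℝ E) : Prop :=
  ∀ ε : ℝ, 0 < ε → ∀ F : Submodule ℝ E, FiniteDimensional ℝ F →
    ∃ T : F →ₗ[ℝ] Z,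
      (∀ x : F, (x : E) ∈ Z → ((T x : Z) : E) = x) ∧
      ∀ x : F, (1 - ε) * ‖x‖ ≤ ‖T x‖ ∧ ‖T x‖ ≤ (1 + ε) * ‖x‖

namespace FreeBanachLattice

variable (E : Type*) [NormedAddCommGroup E] [NormedSpace ℝ E]

variable {E} in
/-- The finite families of functionals `x₁, …, xₙ` with `sup_{‖e‖ ≤ 1} ∑ |xᵢ e| ≤ 1`. -/
def Admissible {n : ℕ} (x : Fin n → StrongDual ℝ E) : Prop :=
  ∀ e : E, ‖e‖ ≤ 1 → ∑ i, |x i e| ≤ 1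

variable {E} in
/-- The set of sums whose supremum is the norm of `f` in the free Banach lattice. -/
def sums (f : StrongDual ℝ E → ℝ) : Set ℝ :=
  {s | ∃ (n : ℕ) (x : Fin n → StrongDual ℝ E), Admissible x ∧ s = ∑ i, |f (x i)|}

variable {E} in
/-- Positively homogeneous functions on the dual with finite free Banach lattice norm. -/
def IsMem (f : StrongDual ℝ E → ℝ) : Prop :=
  (∀ (c : ℝ) (x : StrongDual ℝ E), 0 ≤ c → f (c • x) = c * f x) ∧ BddAbove (sums f)

variable {E} in
theorem zero_mem_sums (f : StrongDual ℝ E → ℝ) : (0 : ℝ) ∈ sums f :=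
  ⟨0, Fin.elim0, fun _ _ => by simp, by simp⟩

variable {E} in
theorem bdd_of_le {f g h : StrongDual ℝ E → ℝ} (hf : BddAbove (sums f))
    (hg : BddAbove (sums g)) (H : ∀ x, |h x| ≤ |f x| + |g x|) : BddAbove (sums h) := by
  obtain ⟨a, ha⟩ := hf
  obtain ⟨b, hb⟩ := hg
  refine ⟨a + b, ?_⟩
  rintro s ⟨n, x, hx, rfl⟩
  have h1 := ha ⟨n, x, hx, rfl⟩
  have h2 := hb ⟨n, x, hx, rfl⟩
  calc ∑ i, |h (x i)| ≤ ∑ i, (|f (x i)| + |g (x i)|) := Finset.sum_le_sum fun i _ => H (x i)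
    _ ≤ a + b := by rw [Finset.sum_add_distrib]; exact add_le_add h1 h2

variable {E} in
theorem IsMem.add {f g : StrongDual ℝ E → ℝ} (hf : IsMem f) (hg : IsMem g) :
    IsMem (f + g) :=
  ⟨fun c x hc => by simp only [Pi.add_apply, hf.1 c x hc, hg.1 c x hc, mul_add],
    bdd_of_le hf.2 hg.2 fun x => abs_add_le _ _⟩

variable {E} in
theorem IsMem.sup {f g : StrongDual ℝ E → ℝ} (hf : IsMem f) (hg : IsMem g) :
    IsMem (f ⊔ g) :=
  ⟨fun c x hc => by
      simp only [Pi.sup_apply, hf.1 c x hc, hg.1 c x hc]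
      exact (mul_max_of_nonneg _ _ hc).symm,
    bdd_of_le hf.2 hg.2 fun x => by
      refine (abs_max_le_max_abs_abs).trans ?_
      exact max_le (le_add_of_nonneg_right (abs_nonneg _)) (le_add_of_nonneg_left (abs_nonneg _))⟩

variable {E} in
theorem IsMem.inf {f g : StrongDual ℝ E → ℝ} (hf : IsMem f) (hg : IsMem g) :
    IsMem (f ⊓ g) :=
  ⟨fun c x hc => by
      simp only [Pi.inf_apply, hf.1 c x hc, hg.1 c x hc]
      exact (mul_min_of_nonneg _ _ hc).symm,
    bdd_of_le hf.2 hg.2 fun x => by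
      refine (abs_min_le_max_abs_abs).trans ?_
      exact max_le (le_add_of_nonneg_right (abs_nonneg _)) (le_add_of_nonneg_left (abs_nonneg _))⟩

variable {E} in
theorem sums_smul_le {f : StrongDual ℝ E → ℝ} (hf : BddAbove (sums f)) (r : ℝ) :
    ∀ s ∈ sums (r • f), s ≤ |r| * sSup (sums f) := by
  rintro s ⟨n, x, hx, rfl⟩
  have h1 := le_csSup hf ⟨n, x, hx, rfl⟩
  calc ∑ i, |(r • f) (x i)| = |r| * ∑ i, |f (x i)| := by
        simp [Finset.mul_sum, abs_mul]
    _ ≤ _ := mul_le_mul_of_nonneg_left h1 (abs_nonneg r)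

/-- The vector space of positively homogeneous functions with finite norm. -/
def ambientSubmodule : Submodule ℝ (StrongDual ℝ E → ℝ) where
  carrier := {f | IsMem f}
  add_mem' := fun hf hg => IsMem.add hf hg
  zero_mem' := ⟨by simp, 0, by rintro s ⟨n, x, -, rfl⟩; simp⟩
  smul_mem' := fun r f hf =>
    ⟨fun c x hc => by
        simp only [Pi.smul_apply, smul_eq_mul, hf.1 c x hc]; ring,
      ⟨_, sums_smul_le hf.2 r⟩⟩

/-- The Banach lattice of positively homogeneous functions on the dual of `E` with finite
norm, with pointwise operations and order. (A type synonym, so that it does not carry the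
topology of pointwise convergence.) -/
def Ambient : Type _ := ↥(ambientSubmodule E)

instance : AddCommGroup (Ambient E) := inferInstanceAs (AddCommGroup ↥(ambientSubmodule E))

instance : Module ℝ (Ambient E) := inferInstanceAs (Module ℝ ↥(ambientSubmodule E))

instance : Lattice (Ambient E) :=
  Subtype.lattice (P := fun f : StrongDual ℝ E → ℝ => IsMem f)
    (fun _ _ hf hg => hf.sup hg) (fun _ _ hf hg => hf.inf hg)

instance : CoeFun (Ambient E) (fun _ => StrongDual ℝ E → ℝ) := ⟨fun f => f.1⟩

/-- `‖f‖ = sup {∑ |f xᵢ| : sup_{‖e‖ ≤ 1} ∑ |xᵢ e| ≤ 1}`. -/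
instance : Norm (Ambient E) := ⟨fun f => sSup (sums f.1)⟩

variable {E}

theorem sum_le_norm (f : Ambient E) {n : ℕ} (x : Fin n → StrongDual ℝ E) (hx : Admissible x) :
    ∑ i, |f (x i)| ≤ ‖f‖ :=
  le_csSup f.2.2 ⟨n, x, hx, rfl⟩

theorem norm_le (f : Ambient E) {a : ℝ} (h : ∀ s ∈ sums f.1, s ≤ a) : ‖f‖ ≤ a :=
  csSup_le ⟨0, zero_mem_sums f.1⟩ h

theorem norm_nonneg_aux (f : Ambient E) : 0 ≤ ‖f‖ :=
  le_csSup f.2.2 (zero_mem_sums f.1)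

theorem abs_apply_le (f : Ambient E) (x : StrongDual ℝ E) : |f x| ≤ ‖x‖ * ‖f‖ := by
  have key : ∀ y : StrongDual ℝ E, ‖y‖ ≤ 1 → |f y| ≤ ‖f‖ := by
    intro y hy
    have := sum_le_norm f (fun _ : Fin 1 => y) (fun e he => by
      have h1 := y.le_opNorm e
      have h2 : ‖y‖ * ‖e‖ ≤ 1 := mul_le_one₀ hy (norm_nonneg e) he
      simpa using h1.trans h2)
    simpa using this
  by_cases hx : x = 0
  · have h0 : f (0 : StrongDual ℝ E) = 0 := by
      have := f.2.1 0 0 le_rfl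
      simpa using this
    subst hx
    simp only [h0]
    simp
  · have hpos : 0 < ‖x‖ := norm_pos_iff.mpr hx
    have h1 := key (‖x‖⁻¹ • x) (by
      rw [norm_smul, norm_inv, norm_norm, inv_mul_cancel₀ hpos.ne'])
    have h2 : f x = ‖x‖ * f (‖x‖⁻¹ • x) := by
      rw [← f.2.1 _ _ hpos.le, smul_smul, mul_inv_cancel₀ hpos.ne', one_smul]
    rw [h2, abs_mul, abs_of_pos hpos]
    exact mul_le_mul_of_nonneg_left h1 hpos.le

theorem norm_smul_le_aux (r : ℝ) (f : Ambient E) : ‖r • f‖ ≤ |r| * ‖f‖ :=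
  norm_le _ (sums_smul_le f.2.2 r)

theorem core : NormedSpace.Core ℝ (Ambient E) where
  norm_nonneg := norm_nonneg_aux
  norm_smul := fun r f => by
    refine le_antisymm (norm_smul_le_aux r f) ?_
    by_cases hr : r = 0
    · subst hr
      simpa using norm_nonneg_aux ((0 : ℝ) • f)
    · have h := norm_smul_le_aux r⁻¹ (r • f)
      rw [smul_smul, inv_mul_cancel₀ hr, one_smul, abs_inv] at h
      have hpos : 0 < |r| := abs_pos.mpr hr
      calc ‖r‖ * ‖f‖ ≤ |r| * (|r|⁻¹ * ‖r • f‖) := mul_le_mul_of_nonneg_left h hpos.le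
        _ = ‖r • f‖ := by rw [← mul_assoc, mul_inv_cancel₀ hpos.ne', one_mul]
  norm_triangle := fun f g => norm_le _ (by
    rintro s ⟨n, x, hx, rfl⟩
    calc ∑ i, |(f + g).1 (x i)| ≤ ∑ i, (|f (x i)| + |g (x i)|) :=
          Finset.sum_le_sum fun i _ => abs_add_le _ _
      _ ≤ ‖f‖ + ‖g‖ := by
          rw [Finset.sum_add_distrib]
          exact add_le_add (sum_le_norm f x hx) (sum_le_norm g x hx))
  norm_eq_zero_iff := fun f => by
    constructor
    · intro h
      refine Subtype.ext (funext fun x => ?_)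
      have := abs_apply_le f x
      rw [h, mul_zero] at this
      exact abs_nonpos_iff.mp this
    · rintro rfl
      refine le_antisymm (norm_le _ ?_) (norm_nonneg_aux _)
      rintro s ⟨n, x, -, rfl⟩
      exact (Finset.sum_eq_zero fun i _ => abs_zero).le

instance : NormedAddCommGroup (Ambient E) := NormedAddCommGroup.ofCore core

instance : NormedSpace ℝ (Ambient E) := NormedSpace.ofCore core

/-- The evaluation function `δ_e : x ↦ x e` on the dual of `E`. -/
def evalAt (e : E) : Ambient E :=
  ⟨fun x => x e, fun c x _ => by simp, ‖e‖, by
    rintro s ⟨n, x, hx, rfl⟩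
    by_cases he : e = 0
    · simp [he]
    · have hpos : 0 < ‖e‖ := norm_pos_iff.mpr he
      have h := hx (‖e‖⁻¹ • e) (by
        rw [norm_smul, norm_inv, norm_norm, inv_mul_cancel₀ hpos.ne'])
      simp only [map_smul, smul_eq_mul, abs_mul, abs_inv, abs_norm, ← Finset.mul_sum] at h
      calc ∑ i, |x i e| = ‖e‖ * (‖e‖⁻¹ * ∑ i, |x i e|) := by
            rw [← mul_assoc, mul_inv_cancel₀ hpos.ne', one_mul]
        _ ≤ ‖e‖ := mul_le_of_le_one_right hpos.le h⟩

variable (E)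

/-- The free Banach lattice `FBL[E]`: the smallest closed vector sublattice of the Banach
lattice of positively homogeneous functions with finite norm that contains every `δ_e`. -/
def fbl : Submodule ℝ (Ambient E) :=
  sInf {S | IsClosed (S : Set (Ambient E)) ∧ SupClosed (S : Set (Ambient E)) ∧
    InfClosed (S : Set (Ambient E)) ∧ ∀ e : E, evalAt e ∈ S}

variable {E}

/-- The functional `δ_x : f ↦ f x` on `FBL[E]`, for `x` in the dual of `E`. -/
def delta (x : StrongDual ℝ E) : StrongDual ℝ (fbl E) :=
  LinearMap.mkContinuous
    { toFun := fun f => (f : Ambient E) x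
      map_add' := fun _ _ => rfl
      map_smul' := fun _ _ => rfl } ‖x‖ fun f => abs_apply_le f.1 x

end FreeBanachLattice

/-- The equivalence for `E`: a functional `x` on `E` attains its norm if and only if
`δ_x` attains its norm on `FBL[E]`. -/
def NormAttainingEquivalence (E : Type*) [NormedAddCommGroup E] [NormedSpace ℝ E] : Prop :=
  ∀ x : StrongDual ℝ E, IsNormAttaining x ↔ IsNormAttaining (FreeBanachLattice.delta x)

end

universe u

/-!
Suppose that `x` does not attain its norm on `E` but `δ_x` attains its norm at `f ∈ FBL[E]`. Being
in a closed sublattice generated by evaluations, `f` already lies in the one generated by `δ_e` for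
countably many points `e`. Let `Z` be a closed separable almost isometric ideal containing these
points. Ultrafilter limits of the almost isometries into `Z` extend the functionals on `Z` to `E`,
linearly and without increasing the norm, and composition with this extension operator carries `f`
to a norm-one element of `FBL[Z]` whose value at `x|_Z` is `f x`. Thus `‖x‖ = |f x| ≤ ‖x|_Z‖`, so
that `δ_{x|_Z}` attains its norm whereas `x|_Z`, a restriction of the same norm as `x`, does not.

Separable almost isometric ideals come from a closing-off argument. For operators `A` and `B` on
finite-dimensional spaces, `(v, w) ↦ ‖A v + B w‖` is a continuous function on a compact ball, and
such functions form a separable metric space. Over a separable range of `A`, countably many `B`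
therefore approximate all of them; adjoining their ranges and iterating gives the ideal.
-/

namespace FreeBanachLattice

section FreeNorm

variable {E F : Type*} [NormedAddCommGroup E] [NormedSpace ℝ E]
  [NormedAddCommGroup F] [NormedSpace ℝ F]

theorem Admissible.norm_sum_smul_le {n : ℕ} {x : Fin n → StrongDual ℝ E} (hx : Admissible x)
    {s : Fin n → ℝ} (hs : ∀ i, |s i| ≤ 1) : ‖∑ i, s i • x i‖ ≤ 1 := by
  refine ContinuousLinearMap.opNorm_le_of_unit_norm zero_le_one fun e he ↦ ?_
  calc ‖(∑ i, s i • x i) e‖ = |∑ i, s i * x i e| := by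
        simp
    _ ≤ ∑ i, |s i * x i e| := Finset.abs_sum_le_sum_abs _ _
    _ ≤ ∑ i, |x i e| := Finset.sum_le_sum fun i _ ↦ by
        rw [abs_mul]
        exact mul_le_of_le_one_left (abs_nonneg _) (hs i)
    _ ≤ 1 := hx e he.le

theorem Admissible.sum_abs_map_apply_le {n : ℕ} {x : Fin n → StrongDual ℝ F}
    (hx : Admissible x) (φ : StrongDual ℝ F →L[ℝ] StrongDual ℝ E) (e : E) :
    ∑ i, |φ (x i) e| ≤ ‖φ‖ * ‖e‖ := by
  have hsign (r : ℝ) : |(SignType.sign r : ℝ)| ≤ 1 := by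
    rcases lt_trichotomy r 0 with hr | rfl | hr <;> simp [*]
  calc ∑ i, |φ (x i) e| = φ (∑ i, (SignType.sign (φ (x i) e) : ℝ) • x i) e := by
        simp [sign_mul_self]
    _ ≤ ‖φ (∑ i, (SignType.sign (φ (x i) e) : ℝ) • x i)‖ * ‖e‖ :=
        (Real.le_norm_self _).trans (ContinuousLinearMap.le_opNorm _ e)
    _ ≤ ‖φ‖ * ‖e‖ := by
        gcongr
        exact φ.le_of_opNorm_le_of_le le_rfl (hx.norm_sum_smul_le fun i ↦ hsign _)
          |>.trans_eq (mul_one _)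

theorem Admissible.sum_abs_apply_le {n : ℕ} {x : Fin n → StrongDual ℝ E} (hx : Admissible x)
    (e : E) : ∑ i, |x i e| ≤ ‖e‖ :=
  (hx.sum_abs_map_apply_le (ContinuousLinearMap.id ℝ _) e).trans
    (mul_le_of_le_one_left (norm_nonneg e) ContinuousLinearMap.norm_id_le)

theorem sum_abs_apply_le_mul_norm (f : Ambient E) {n : ℕ} {x : Fin n → StrongDual ℝ E} {C : ℝ}
    (hC : 0 ≤ C) (hx : ∀ e : E, ∑ i, |x i e| ≤ C * ‖e‖) : ∑ i, |f (x i)| ≤ C * ‖f‖ := by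
  refine le_mul_of_forall_lt₀ fun c hc b hb ↦ ?_
  have hc₀ : 0 < c := hC.trans_lt hc
  have hadm : Admissible fun i ↦ c⁻¹ • x i := fun e he ↦ by
    calc ∑ i, |(c⁻¹ • x i) e| = c⁻¹ * ∑ i, |x i e| := by
          simp [abs_mul, abs_of_pos hc₀, Finset.mul_sum]
      _ ≤ c⁻¹ * (c * 1) := by
          gcongr
          exact (hx e).trans (by gcongr)
      _ = 1 := by field_simp
  calc ∑ i, |f (x i)| = c * ∑ i, |f (c⁻¹ • x i)| := by
        simp only [f.2.1 _ _ (inv_pos.2 hc₀).le, abs_mul, abs_inv, abs_of_pos hc₀,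
          ← Finset.mul_sum]
        field_simp
    _ ≤ c * b := by
        gcongr
        exact (sum_le_norm f _ hadm).trans hb.le

theorem le_of_mem_sums_comp (φ : StrongDual ℝ F →L[ℝ] StrongDual ℝ E) (f : Ambient E) {s : ℝ}
    (hs : s ∈ sums fun x ↦ f (φ x)) : s ≤ ‖φ‖ * ‖f‖ := by
  obtain ⟨n, x, hx, rfl⟩ := hs
  exact sum_abs_apply_le_mul_norm f (norm_nonneg φ) (hx.sum_abs_map_apply_le φ)

/-- The composition operator `f ↦ f ∘ φ` induced by a bounded operator `φ` between duals. -/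
noncomputable def compOp (φ : StrongDual ℝ F →L[ℝ] StrongDual ℝ E) :
    Ambient E →L[ℝ] Ambient F :=
  LinearMap.mkContinuous
    { toFun f := ⟨fun x ↦ f (φ x),
        fun c x hc ↦ by
          change f (φ (c • x)) = c * f (φ x)
          rw [map_smul]
          exact f.2.1 c _ hc,
        ⟨_, fun _ ↦ le_of_mem_sums_comp φ f⟩⟩
      map_add' _ _ := rfl
      map_smul' _ _ := rfl } ‖φ‖ fun f ↦ norm_le _ fun _ ↦ le_of_mem_sums_comp φ f

theorem norm_compOp_le (φ : StrongDual ℝ F →L[ℝ] StrongDual ℝ E) : ‖compOp φ‖ ≤ ‖φ‖ :=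
  (compOp φ).opNorm_le_bound (norm_nonneg φ) fun f ↦ norm_le _ fun _ ↦ le_of_mem_sums_comp φ f

@[simp]
theorem norm_evalAt (e : E) : ‖evalAt e‖ = ‖e‖ := by
  apply le_antisymm
  · refine norm_le _ ?_
    rintro _ ⟨n, x, hx, rfl⟩
    exact hx.sum_abs_apply_le e
  · obtain ⟨y, hy, hye⟩ := exists_dual_vector'' ℝ e
    calc ‖e‖ = |evalAt e y| := by
          change ‖e‖ = |y e|
          simp [hye]
      _ ≤ ‖y‖ * ‖evalAt e‖ := abs_apply_le _ _
      _ ≤ ‖evalAt e‖ := mul_le_of_le_one_left (norm_nonneg _) hy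

end FreeNorm

section ClosedSublattice

variable {E : Type*} [NormedAddCommGroup E] [NormedSpace ℝ E]

/-- Closed vector sublattices of the lattice of positively homogeneous functions. -/
structure IsClosedSublattice (S : Submodule ℝ (Ambient E)) : Prop where
  isClosed : IsClosed (S : Set (Ambient E))
  supClosed : SupClosed (S : Set (Ambient E))
  infClosed : InfClosed (S : Set (Ambient E))

/-- The closed vector sublattice generated by the evaluations at the points of `A`, that is, the
part of `FBL[E]` that depends only on `A`. -/
def fblOn (A : Set E) : Submodule ℝ (Ambient E) :=
  sInf {S | IsClosedSublattice S ∧ ∀ e ∈ A, evalAt e ∈ S}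

theorem isClosedSublattice_sInf {𝒮 : Set (Submodule ℝ (Ambient E))}
    (h𝒮 : ∀ S ∈ 𝒮, IsClosedSublattice S) : IsClosedSublattice (sInf 𝒮) where
  isClosed := by
    rw [Submodule.coe_sInf]
    exact isClosed_biInter fun S hS ↦ (h𝒮 S hS).isClosed
  supClosed := by
    rw [Submodule.coe_sInf]
    exact supClosed_iInter fun S ↦ supClosed_iInter fun hS ↦ (h𝒮 S hS).supClosed
  infClosed := by
    rw [Submodule.coe_sInf]
    exact infClosed_iInter fun S ↦ infClosed_iInter fun hS ↦ (h𝒮 S hS).infClosed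

theorem isClosedSublattice_fblOn (A : Set E) : IsClosedSublattice (fblOn A) :=
  isClosedSublattice_sInf fun _ hS ↦ hS.1

theorem fblOn_le {A : Set E} {S : Submodule ℝ (Ambient E)} (hS : IsClosedSublattice S)
    (hA : ∀ e ∈ A, evalAt e ∈ S) : fblOn A ≤ S :=
  sInf_le ⟨hS, hA⟩

theorem evalAt_mem_fblOn {A : Set E} {e : E} (he : e ∈ A) : evalAt e ∈ fblOn A :=
  Submodule.mem_sInf.2 fun _ hS ↦ hS.2 e he

theorem fblOn_mono {A B : Set E} (h : A ⊆ B) : fblOn A ≤ fblOn B :=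
  fblOn_le (isClosedSublattice_fblOn B) fun _ he ↦ evalAt_mem_fblOn (h he)

theorem fblOn_univ : fblOn (Set.univ : Set E) = fbl E := by
  refine congrArg sInf (Set.ext fun S ↦ ?_)
  exact ⟨fun ⟨⟨h₁, h₂, h₃⟩, h⟩ ↦ ⟨h₁, h₂, h₃, fun e ↦ h e trivial⟩,
    fun ⟨h₁, h₂, h₃, h⟩ ↦ ⟨⟨h₁, h₂, h₃⟩, fun e _ ↦ h e⟩⟩

theorem isClosedSublattice_fbl : IsClosedSublattice (fbl E) :=
  fblOn_univ (E := E) ▸ isClosedSublattice_fblOn Set.univ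

theorem evalAt_mem_fbl (e : E) : evalAt e ∈ fbl E :=
  fblOn_univ (E := E) ▸ evalAt_mem_fblOn (Set.mem_univ e)

variable (E) in
/-- The elements of `FBL[E]` that are generated by countably many evaluations. -/
def countablyGeneratedPart : Submodule ℝ (Ambient E) where
  carrier := {f | ∃ A : Set E, A.Countable ∧ f ∈ fblOn A}
  add_mem' := by
    rintro f g ⟨A, hA, hf⟩ ⟨B, hB, hg⟩
    exact ⟨A ∪ B, hA.union hB, add_mem (fblOn_mono Set.subset_union_left hf)
      (fblOn_mono Set.subset_union_right hg)⟩
  zero_mem' := ⟨∅, Set.countable_empty, zero_mem _⟩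
  smul_mem' r f := fun ⟨A, hA, hf⟩ ↦ ⟨A, hA, Submodule.smul_mem _ r hf⟩

theorem isClosedSublattice_countablyGeneratedPart :
    IsClosedSublattice (countablyGeneratedPart E) where
  isClosed := by
    refine IsSeqClosed.isClosed fun u f hu huf ↦ ?_
    choose A hA hu using hu
    exact ⟨⋃ n, A n, Set.countable_iUnion hA, (isClosedSublattice_fblOn _).isClosed.mem_of_tendsto
      huf (.of_forall fun n ↦ fblOn_mono (Set.subset_iUnion A n) (hu n))⟩
  supClosed := by
    rintro f ⟨A, hA, hf⟩ g ⟨B, hB, hg⟩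
    exact ⟨A ∪ B, hA.union hB, (isClosedSublattice_fblOn _).supClosed
      (fblOn_mono Set.subset_union_left hf) (fblOn_mono Set.subset_union_right hg)⟩
  infClosed := by
    rintro f ⟨A, hA, hf⟩ g ⟨B, hB, hg⟩
    exact ⟨A ∪ B, hA.union hB, (isClosedSublattice_fblOn _).infClosed
      (fblOn_mono Set.subset_union_left hf) (fblOn_mono Set.subset_union_right hg)⟩

theorem exists_countable_mem_fblOn {f : Ambient E} (hf : f ∈ fbl E) :
    ∃ A : Set E, A.Countable ∧ f ∈ fblOn A := by
  rw [← fblOn_univ] at hf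
  exact fblOn_le isClosedSublattice_countablyGeneratedPart
    (fun e _ ↦ ⟨{e}, Set.countable_singleton e, evalAt_mem_fblOn rfl⟩) hf

end ClosedSublattice

section NormAttaining

variable {E : Type*} [NormedAddCommGroup E] [NormedSpace ℝ E]

theorem norm_delta (x : StrongDual ℝ E) : ‖delta x‖ = ‖x‖ := by
  apply le_antisymm (LinearMap.mkContinuous_norm_le _ (norm_nonneg x) _)
  refine x.opNorm_le_bound (norm_nonneg (delta x)) fun e ↦ ?_
  have h := (delta x).le_opNorm ⟨evalAt e, evalAt_mem_fbl e⟩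
  rwa [Submodule.coe_norm, norm_evalAt] at h

theorem isNormAttaining_delta_iff {x : StrongDual ℝ E} :
    IsNormAttaining (delta x) ↔ ∃ f ∈ fbl E, ‖f‖ = 1 ∧ |f x| = ‖x‖ := by
  rw [IsNormAttaining, norm_delta]
  exact ⟨fun ⟨f, hf, hfx⟩ ↦ ⟨f, f.2, hf, hfx⟩, fun ⟨f, hfE, hf, hfx⟩ ↦ ⟨⟨f, hfE⟩, hf, hfx⟩⟩

end NormAttaining

end FreeBanachLattice

theorem IsNormAttaining.delta {E : Type*} [NormedAddCommGroup E] [NormedSpace ℝ E]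
    {x : StrongDual ℝ E} (hx : IsNormAttaining x) :
    IsNormAttaining (FreeBanachLattice.delta x) := by
  obtain ⟨e, he, hxe⟩ := hx
  exact FreeBanachLattice.isNormAttaining_delta_iff.2 ⟨FreeBanachLattice.evalAt e,
    FreeBanachLattice.evalAt_mem_fbl e, (FreeBanachLattice.norm_evalAt e).trans he, hxe⟩

section HahnBanachExtensionOperator

variable {E F : Type*} [NormedAddCommGroup E] [NormedSpace ℝ E]
  [NormedAddCommGroup F] [NormedSpace ℝ F] {j : F →ₗᵢ[ℝ] E}

/-- `φ` is a Hahn–Banach extension operator along the isometric embedding `j` of `F` into `E`: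
linearly in `y`, it extends the functionals `y` on `F` to functionals on `E` of the same norm. -/
structure IsHahnBanachExtensionOperator (j : F →ₗᵢ[ℝ] E)
    (φ : StrongDual ℝ F →L[ℝ] StrongDual ℝ E) : Prop where
  apply_embedding (y : StrongDual ℝ F) (z : F) : φ y (j z) = y z
  norm_le_one : ‖φ‖ ≤ 1

namespace IsHahnBanachExtensionOperator

open FreeBanachLattice

variable {φ : StrongDual ℝ F →L[ℝ] StrongDual ℝ E}

theorem compOp_evalAt (hφ : IsHahnBanachExtensionOperator j φ) (z : F) :
    compOp φ (evalAt (j z)) = evalAt z :=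
  Subtype.ext (funext fun y ↦ hφ.apply_embedding y z)

theorem compOp_mem_fbl (hφ : IsHahnBanachExtensionOperator j φ) {f : Ambient E}
    (hf : f ∈ fblOn (Set.range j)) : compOp φ f ∈ fbl F := by
  have hS : IsClosedSublattice ((fbl F).comap (compOp φ).toLinearMap) :=
    { isClosed := isClosedSublattice_fbl.isClosed.preimage (compOp φ).continuous
      supClosed := fun _ hf _ hg ↦ isClosedSublattice_fbl.supClosed hf hg
      infClosed := fun _ hf _ hg ↦ isClosedSublattice_fbl.infClosed hf hg }
  refine fblOn_le hS ?_ hf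
  rintro _ ⟨z, rfl⟩
  change compOp φ (evalAt (j z)) ∈ fbl F
  rw [hφ.compOp_evalAt]
  exact evalAt_mem_fbl z

theorem compOp_precomp_compOp (hφ : IsHahnBanachExtensionOperator j φ) {f : Ambient E}
    (hf : f ∈ fblOn (Set.range j)) :
    compOp (j.toContinuousLinearMap.precomp ℝ) (compOp φ f) = f := by
  let R := compOp (j.toContinuousLinearMap.precomp ℝ) ∘L compOp φ
  have hS : IsClosedSublattice (LinearMap.eqLocus R.toLinearMap LinearMap.id) :=
    { isClosed := isClosed_eq R.continuous continuous_id
      supClosed := fun _ hf _ hg ↦ congrArg₂ (· ⊔ ·) hf hg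
      infClosed := fun _ hf _ hg ↦ congrArg₂ (· ⊓ ·) hf hg }
  refine fblOn_le hS ?_ hf
  rintro _ ⟨z, rfl⟩
  exact congrArg (compOp (j.toContinuousLinearMap.precomp ℝ)) (hφ.compOp_evalAt z)

theorem norm_compOp (hφ : IsHahnBanachExtensionOperator j φ) {f : Ambient E}
    (hf : f ∈ fblOn (Set.range j)) : ‖compOp φ f‖ = ‖f‖ := by
  have norm_precomp_le :
      ‖j.toContinuousLinearMap.precomp (σ := RingHom.id ℝ) (τ := RingHom.id ℝ) ℝ‖ ≤ 1 :=
    ContinuousLinearMap.opNorm_le_bound _ zero_le_one fun x ↦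
      (x.opNorm_comp_le j.toContinuousLinearMap).trans <| by
        rw [one_mul]
        exact mul_le_of_le_one_right (norm_nonneg x) j.norm_toContinuousLinearMap_le
  apply le_antisymm
  · simpa using (compOp φ).le_of_opNorm_le ((norm_compOp_le φ).trans hφ.norm_le_one) f
  · conv_lhs => rw [← hφ.compOp_precomp_compOp hf]
    simpa using (compOp (j.toContinuousLinearMap.precomp ℝ)).le_of_opNorm_le
      ((norm_compOp_le _).trans norm_precomp_le) (compOp φ f)

theorem isNormAttaining_of_mem_fblOn (hφ : IsHahnBanachExtensionOperator j φ)
    (hF : NormAttainingEquivalence F) {x : StrongDual ℝ E} {f : Ambient E}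
    (hf : f ∈ fblOn (Set.range j)) (hf₁ : ‖f‖ = 1) (hfx : |f x| = ‖x‖) : IsNormAttaining x := by
  let y : StrongDual ℝ F := x ∘L j.toContinuousLinearMap
  have hnorm : ‖compOp φ f‖ = 1 := (hφ.norm_compOp hf).trans hf₁
  have hval : |compOp φ f y| = ‖x‖ := by
    rw [← hfx]
    conv_rhs => rw [← hφ.compOp_precomp_compOp hf]
    rfl
  have hrestrict : ‖y‖ = ‖x‖ := by
    apply le_antisymm
    · exact (x.opNorm_comp_le _).trans
        (mul_le_of_le_one_right (norm_nonneg x) j.norm_toContinuousLinearMap_le)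
    · simpa [hnorm, hval] using abs_apply_le (compOp φ f) y
  obtain ⟨z, hz, hyz⟩ := (hF y).2
    (isNormAttaining_delta_iff.2 ⟨_, hφ.compOp_mem_fbl hf, hnorm, hval.trans hrestrict.symm⟩)
  exact ⟨j z, (j.norm_map z).trans hz, hyz.trans hrestrict⟩

end IsHahnBanachExtensionOperator

end HahnBanachExtensionOperator

section UltrafilterLimit

open Filter Topology

variable {ι E F : Type*} [NormedAddCommGroup E] [NormedSpace ℝ E]
  [NormedAddCommGroup F] [NormedSpace ℝ F]

theorem exists_tendsto_dual_apply {U : Ultrafilter ι} {u : ι → F} {r : ℝ}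
    (hu : ∀ C, r < C → ∀ᶠ i in U, ‖u i‖ ≤ C) (y : StrongDual ℝ F) :
    ∃ l : ℝ, Tendsto (fun i ↦ y (u i)) U (𝓝 l) ∧ ‖l‖ ≤ ‖y‖ * r := by
  have hy {C : ℝ} (hC : r < C) : ∀ᶠ i in U, ‖y (u i)‖ ≤ ‖y‖ * C :=
    (hu C hC).mono fun i hi ↦ y.le_of_opNorm_le_of_le le_rfl hi
  obtain ⟨l, -, hl⟩ := (isCompact_closedBall (0 : ℝ) (‖y‖ * (r + 1))).ultrafilter_le_nhds
    (U.map fun i ↦ y (u i)) (le_principal_iff.2 <| (hy (lt_add_one r)).mono fun i hi ↦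
      mem_closedBall_zero_iff.2 hi)
  have hl' : Tendsto (fun i ↦ y (u i)) U (𝓝 l) := hl
  refine ⟨l, hl', ?_⟩
  have hle (C : ℝ) (hC : r < C) : ‖l‖ ≤ ‖y‖ * C := le_of_tendsto hl'.norm (hy hC)
  exact ge_of_tendsto ((continuous_const_mul ‖y‖).continuousWithinAt (s := Set.Ioi r))
    (eventually_mem_nhdsWithin.mono hle)

theorem exists_dualMap_tendsto {U : Ultrafilter ι} {T : ι → E →ₗ[ℝ] F}
    (hT : ∀ e C, ‖e‖ < C → ∀ᶠ i in U, ‖T i e‖ ≤ C) :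
    ∃ φ : StrongDual ℝ F →L[ℝ] StrongDual ℝ E,
      ‖φ‖ ≤ 1 ∧ ∀ y e, Tendsto (fun i ↦ y (T i e)) U (𝓝 (φ y e)) := by
  choose p hp hp_le using fun y e ↦ exists_tendsto_dual_apply (hT e) y
  let B : StrongDual ℝ F →ₗ[ℝ] E →ₗ[ℝ] ℝ := LinearMap.mk₂ ℝ p
    (fun y y' e ↦ tendsto_nhds_unique (hp (y + y') e) ((hp y e).add (hp y' e)))
    (fun c y e ↦ tendsto_nhds_unique (hp (c • y) e) ((hp y e).const_mul c))
    (fun y e e' ↦ tendsto_nhds_unique (hp y (e + e')) <| by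
      simpa only [map_add] using (hp y e).add (hp y e'))
    (fun c y e ↦ tendsto_nhds_unique (hp y (c • e)) <| by
      simpa only [map_smul] using (hp y e).const_smul c)
  have hB (y : StrongDual ℝ F) (e : E) : ‖B y e‖ ≤ 1 * ‖y‖ * ‖e‖ := by
    rw [one_mul]
    exact hp_le y e
  exact ⟨B.mkContinuous₂ 1 hB, LinearMap.mkContinuous₂_norm_le _ zero_le_one hB, hp⟩

end UltrafilterLimit

namespace IsAlmostIsometricIdeal

open Filter Topology

variable {E : Type*} [NormedAddCommGroup E] [NormedSpace ℝ E] {Z : Submodule ℝ E}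

theorem exists_almostContraction_finset (hZ : IsAlmostIsometricIdeal Z) (A : Finset E) {ε : ℝ}
    (hε : 0 < ε) : ∃ T : E →ₗ[ℝ] Z,
      (∀ z : Z, (z : E) ∈ A → T z = z) ∧ ∀ e ∈ A, ‖T e‖ ≤ (1 + ε) * ‖e‖ := by
  obtain ⟨T, hTZ, hT⟩ := hZ ε hε (Submodule.span ℝ A) (FiniteDimensional.span_finset ℝ A)
  obtain ⟨T', rfl⟩ := T.exists_extend
  exact ⟨T', fun z hz ↦ Subtype.ext (hTZ ⟨z, Submodule.subset_span hz⟩ z.2),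
    fun e he ↦ (hT ⟨e, Submodule.subset_span he⟩).2⟩

theorem exists_asymptotic_retraction (hZ : IsAlmostIsometricIdeal Z) :
    ∃ (U : Ultrafilter (Finset E × ℝ)) (T : Finset E × ℝ → E →ₗ[ℝ] Z),
      (∀ z : Z, ∀ᶠ i in U, T i z = z) ∧ ∀ e C, ‖e‖ < C → ∀ᶠ i in U, ‖T i e‖ ≤ C := by
  choose! T hTZ hT using fun i : Finset E × ℝ ↦ hZ.exists_almostContraction_finset i.1 (ε := i.2)
  let l : Filter (Finset E × ℝ) := atTop ×ˢ 𝓝[>] 0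
  have hmem (e : E) : ∀ᶠ i in l, e ∈ i.1 :=
    tendsto_fst.eventually <| (eventually_ge_atTop {e}).mono fun A hA ↦
      Finset.singleton_subset_iff.1 hA
  have hpos : ∀ᶠ i in l, 0 < i.2 := tendsto_snd.eventually eventually_mem_nhdsWithin
  refine ⟨Ultrafilter.of l, T, fun z ↦ Ultrafilter.of_le l ?_,
    fun e C hC ↦ Ultrafilter.of_le l ?_⟩
  · filter_upwards [hpos, hmem z] with i hi hz using hTZ i hi z hz
  · have hlim : Tendsto (fun i : Finset E × ℝ ↦ (1 + i.2) * ‖e‖) l (𝓝 ‖e‖) := by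
      have hsnd : Tendsto Prod.snd l (𝓝 0) := tendsto_snd.mono_right nhdsWithin_le_nhds
      simpa using (hsnd.const_add 1).mul_const ‖e‖
    filter_upwards [hpos, hmem e, hlim.eventually_le_const hC] with i hi he hiC
    exact (hT i hi e he).trans hiC

theorem exists_isHahnBanachExtensionOperator (hZ : IsAlmostIsometricIdeal Z) :
    ∃ φ, IsHahnBanachExtensionOperator Z.subtypeₗᵢ φ := by
  obtain ⟨U, T, hTZ, hT⟩ := hZ.exists_asymptotic_retraction
  obtain ⟨φ, hφ, hφT⟩ := exists_dualMap_tendsto hT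
  refine ⟨φ, fun y z ↦ tendsto_nhds_unique (hφT y z) (tendsto_const_nhds.congr' ?_), hφ⟩
  filter_upwards [hTZ z] with i hi
  rw [hi]

end IsAlmostIsometricIdeal

section Reflection

open TopologicalSpace

variable {E V W : Type*} [NormedAddCommGroup E] [NormedSpace ℝ E] [NormedAddCommGroup V]
  [NormedSpace ℝ V] [NormedAddCommGroup W] [NormedSpace ℝ W]

/-- The restriction of `v ↦ ‖T v‖` to the unit ball, as a point of a space of continuous functions
that is separable if `V` is finite-dimensional. -/
def normOnBall (T : V →L[ℝ] E) : C(Metric.closedBall (0 : V) 1, ℝ) where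
  toFun v := ‖T v‖

theorem abs_norm_sub_norm_le_dist_normOnBall [ProperSpace V] (S T : V →L[ℝ] E) (v : V) :
    |‖S v‖ - ‖T v‖| ≤ dist (normOnBall S) (normOnBall T) * ‖v‖ := by
  rcases eq_or_ne v 0 with rfl | hv
  · simp
  let u : Metric.closedBall (0 : V) 1 :=
    ⟨‖v‖⁻¹ • v, mem_closedBall_zero_iff.2 (norm_smul_inv_norm (𝕜 := ℝ) hv).le⟩
  have hu (R : V →L[ℝ] E) : ‖R v‖ = normOnBall R u * ‖v‖ := by
    change ‖R v‖ = ‖R (‖v‖⁻¹ • v)‖ * ‖v‖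
    rw [map_smul, norm_smul, norm_inv, norm_norm]
    field_simp
  rw [hu S, hu T, ← sub_mul, abs_mul, abs_norm]
  gcongr
  exact ContinuousMap.dist_apply_le_dist (f := normOnBall S) (g := normOnBall T) u

theorem abs_norm_coprod_sub_norm_coprod_le (A A' : V →L[ℝ] E) (B : W →L[ℝ] E) (p : V × W) :
    |‖A.coprod B p‖ - ‖A'.coprod B p‖| ≤ dist A A' * ‖p‖ :=
  calc |‖A.coprod B p‖ - ‖A'.coprod B p‖| ≤ ‖(A - A') p.1‖ := by
        simpa using abs_norm_sub_norm_le (A.coprod B p) (A'.coprod B p)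
    _ ≤ dist A A' * ‖p‖ := by
        rw [dist_eq_norm]
        exact (A - A').le_of_opNorm_le_of_le le_rfl (norm_fst_le p)

theorem exists_countable_forall_dist_lt {α β : Type*} [PseudoMetricSpace β]
    [SecondCountableTopology β] (G : α → β) :
    ∃ s : Set α, s.Countable ∧ ∀ a, ∀ δ > 0, ∃ d ∈ s, dist (G a) (G d) < δ := by
  let _ := PseudoMetricSpace.induced G ‹_›
  have : SecondCountableTopology α := secondCountableTopology_induced α β G
  obtain ⟨s, hs, hs_dense⟩ := exists_countable_dense α
  exact ⟨s, hs, fun a δ hδ ↦ hs_dense.exists_dist_lt a hδ⟩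

theorem exists_countable_norm_coprod_approx [FiniteDimensional ℝ V] [FiniteDimensional ℝ W]
    {S : Submodule ℝ E} (hS : IsSeparable (S : Set E)) :
    ∃ 𝒟 : Set (W →L[ℝ] E), 𝒟.Countable ∧
      ∀ (A : V →L[ℝ] E) (B : W →L[ℝ] E), (∀ v, A v ∈ S) → ∀ η > 0,
        ∃ D ∈ 𝒟, ∀ p, |‖A.coprod B p‖ - ‖A.coprod D p‖| ≤ η * ‖p‖ := by
  have := hS.separableSpace
  have := UniformSpace.secondCountable_of_separable S
  have := FiniteDimensional.proper ℝ (V × W)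
  let G (q : (V →L[ℝ] S) × (W →L[ℝ] E)) :
      (V →L[ℝ] S) × C(Metric.closedBall (0 : V × W) 1, ℝ) :=
    (q.1, normOnBall ((S.subtypeL ∘L q.1).coprod q.2))
  obtain ⟨s, hs, hs_approx⟩ := exists_countable_forall_dist_lt G
  refine ⟨Prod.snd '' s, hs.image _, fun A B hA η hη ↦ ?_⟩
  obtain ⟨⟨A', D⟩, hs_mem, hdist⟩ := hs_approx (A.codRestrict S hA, B) (η / 2) (half_pos hη)
  obtain ⟨hA', hnorm⟩ := max_lt_iff.1 hdist
  refine ⟨D, ⟨_, hs_mem, rfl⟩, fun p ↦ ?_⟩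
  have hdistA : dist (S.subtypeL ∘L A') A ≤ η / 2 := by
    have hsub : S.subtypeL ∘L A' - A = S.subtypeₗᵢ.toContinuousLinearMap ∘L
        (A' - A.codRestrict S hA) := by ext; simp
    rw [dist_eq_norm, hsub, LinearIsometry.norm_toContinuousLinearMap_comp, ← dist_eq_norm,
      dist_comm]
    exact hA'.le
  calc |‖A.coprod B p‖ - ‖A.coprod D p‖|
      ≤ |‖A.coprod B p‖ - ‖(S.subtypeL ∘L A').coprod D p‖|
        + |‖(S.subtypeL ∘L A').coprod D p‖ - ‖A.coprod D p‖| := abs_sub_le _ _ _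
    _ ≤ η / 2 * ‖p‖ + η / 2 * ‖p‖ := by
        gcongr
        · refine (abs_norm_sub_norm_le_dist_normOnBall _ _ p).trans ?_
          gcongr
          exact hnorm.le
        · refine (abs_norm_coprod_sub_norm_coprod_le _ _ _ p).trans ?_
          gcongr
    _ = η * ‖p‖ := by ring

/-- `R` contains copies, over `S` and up to any precision, of all finite-dimensional subspaces of
`E`: in the norm of `A v + B w` with `A v ∈ S`, the operator `B` can be replaced by one into `R`. -/
def ReflectsOver (R S : Submodule ℝ E) : Prop :=
  ∀ (m k : ℕ) (A : (Fin m → ℝ) →L[ℝ] E) (B : (Fin k → ℝ) →L[ℝ] E), (∀ v, A v ∈ S) → ∀ η > 0,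
    ∃ D : (Fin k → ℝ) →L[ℝ] E, (∀ w, D w ∈ R) ∧
      ∀ p, |‖A.coprod B p‖ - ‖A.coprod D p‖| ≤ η * ‖p‖

theorem ReflectsOver.mono_left {R R' S : Submodule ℝ E} (h : ReflectsOver R S) (hR : R ≤ R') :
    ReflectsOver R' S := fun m k A B hA η hη ↦
  let ⟨D, hD, hBD⟩ := h m k A B hA η hη
  ⟨D, fun w ↦ hR (hD w), hBD⟩

theorem mem_closure_setOf_forall_apply_mem {ι : Type*} [Finite ι] {S : Submodule ℝ E}
    {A : (ι → ℝ) →L[ℝ] E} (hA : ∀ v, A v ∈ S.topologicalClosure) :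
    A ∈ closure {A' : (ι → ℝ) →L[ℝ] E | ∀ v, A' v ∈ S} := by
  classical
  cases nonempty_fintype ι
  let e : ((ι → ℝ) →L[ℝ] E) ≃L[ℝ] (ι → E) := ContinuousLinearEquiv.piRing ι
  have he : e A ∈ closure (Set.univ.pi fun _ ↦ (S : Set E)) := by
    rw [closure_pi_set]
    exact fun i _ ↦ hA (Pi.single i 1)
  have hsymm (a : ι → E) (v : ι → ℝ) : e.symm a v = ∑ i, v i • a i :=
    LinearEquiv.piRing_symm_apply (R := ℝ) (S := ℝ) a v
  rw [← e.symm_apply_apply A]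
  refine map_mem_closure e.symm.continuous he fun a ha v ↦ ?_
  rw [hsymm]
  exact S.sum_mem fun i _ ↦ S.smul_mem _ (ha i trivial)

theorem ReflectsOver.topologicalClosure_right {R S : Submodule ℝ E} (h : ReflectsOver R S) :
    ReflectsOver R S.topologicalClosure := by
  intro m k A B hA η hη
  obtain ⟨A', hA'S, hAA'⟩ := Metric.mem_closure_iff.1 (mem_closure_setOf_forall_apply_mem hA)
    (η / 3) (by positivity)
  obtain ⟨D, hDR, hD⟩ := h m k A' B hA'S (η / 3) (by positivity)
  refine ⟨D, hDR, fun p ↦ ?_⟩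
  calc |‖A.coprod B p‖ - ‖A.coprod D p‖|
      ≤ |‖A.coprod B p‖ - ‖A'.coprod B p‖| + (|‖A'.coprod B p‖ - ‖A'.coprod D p‖|
        + |‖A'.coprod D p‖ - ‖A.coprod D p‖|) :=
        (abs_sub_le _ _ _).trans (by gcongr; exact abs_sub_le _ _ _)
    _ ≤ dist A A' * ‖p‖ + (η / 3 * ‖p‖ + dist A' A * ‖p‖) := by
        gcongr
        exacts [abs_norm_coprod_sub_norm_coprod_le .., hD p, abs_norm_coprod_sub_norm_coprod_le ..]
    _ ≤ η / 3 * ‖p‖ + (η / 3 * ‖p‖ + η / 3 * ‖p‖) := by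
        rw [dist_comm A' A]
        gcongr
    _ = η * ‖p‖ := by ring

theorem reflectsOver_iSup {ι : Type*} [Nonempty ι] {S : ι → Submodule ℝ E}
    (hS : Directed (· ≤ ·) S) (h : ∀ i, ∃ j, ReflectsOver (S j) (S i)) :
    ReflectsOver (⨆ i, S i) (⨆ i, S i) := by
  intro m k A B hA η hη
  have hfg : (LinearMap.range A.toLinearMap).FG := LinearMap.range_eq_map A.toLinearMap ▸
    Submodule.FG.map _ Module.Finite.fg_top
  have hrange : LinearMap.range A.toLinearMap ≤ ⨆ i, S i := by
    rintro _ ⟨v, rfl⟩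
    exact hA v
  obtain ⟨_, ⟨i, rfl⟩, hi⟩ := (Submodule.fg_iff_compact _).1 hfg (Set.range S) (⨆ i, S i)
    (Set.range_nonempty S) hS.directedOn_range isLUB_iSup hrange
  obtain ⟨j, hj⟩ := h i
  exact hj.mono_left (le_iSup S j) m k A B (fun v ↦ hi ⟨v, rfl⟩) η hη

theorem exists_isSeparable_reflectsOver {S : Submodule ℝ E} (hS : IsSeparable (S : Set E)) :
    ∃ R : Submodule ℝ E, IsSeparable (R : Set E) ∧ S ≤ R ∧ ReflectsOver R S := by
  choose 𝒟 h𝒟 h𝒟_approx using fun m k ↦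
    exists_countable_norm_coprod_approx (V := Fin m → ℝ) (W := Fin k → ℝ) hS
  let R : Submodule ℝ E :=
    Submodule.span ℝ (S ∪ ⋃ (m) (k) (D : 𝒟 m k), Set.range D.1)
  have hDR {m k : ℕ} {D : (Fin k → ℝ) →L[ℝ] E} (hD : D ∈ 𝒟 m k) (w : Fin k → ℝ) : D w ∈ R :=
    Submodule.subset_span <| .inr <| Set.mem_iUnion₂_of_mem (i := m) (j := k) <|
      Set.mem_iUnion_of_mem ⟨D, hD⟩ ⟨w, rfl⟩
  refine ⟨R, ?_, fun e he ↦ Submodule.subset_span (.inl he), fun m k A B hA η hη ↦ ?_⟩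
  · refine IsSeparable.span (hS.union ?_)
    have (m k : ℕ) : Countable (𝒟 m k) := (h𝒟 m k).to_subtype
    exact .iUnion fun m ↦ .iUnion fun k ↦ .iUnion fun D ↦ isSeparable_range D.1.continuous
  · obtain ⟨D, hD, hBD⟩ := h𝒟_approx m k A B hA η hη
    exact ⟨D, hDR hD, hBD⟩

end Reflection

section SeparableIdeals

open TopologicalSpace Module

variable {E : Type*} [NormedAddCommGroup E] [NormedSpace ℝ E]

theorem exists_adapted_coordinates [FiniteDimensional ℝ E] (P : Submodule ℝ E) :
    ∃ (m k : ℕ) (A : (Fin m → ℝ) →L[ℝ] E) (B : (Fin k → ℝ) →L[ℝ] E)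
      (Ψ : E →L[ℝ] (Fin m → ℝ) × (Fin k → ℝ)),
      (∀ v, A v ∈ P) ∧ (∀ x, A.coprod B (Ψ x) = x) ∧ ∀ x ∈ P, (Ψ x).2 = 0 := by
  obtain ⟨π, hπ⟩ := P.subtype.exists_leftInverse_of_injective P.ker_subtype
  let α : (Fin (finrank ℝ P) → ℝ) ≃L[ℝ] P := .ofFinrankEq (by simp)
  let β : (Fin (finrank ℝ E) → ℝ) ≃L[ℝ] E := .ofFinrankEq (by simp)
  let Ψ : E →ₗ[ℝ] (Fin (finrank ℝ P) → ℝ) × (Fin (finrank ℝ E) → ℝ) :=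
    (α.symm.toLinearMap ∘ₗ π).prod (β.symm.toLinearMap ∘ₗ (LinearMap.id - P.subtype ∘ₗ π))
  refine ⟨_, _, P.subtypeL ∘L α, β, LinearMap.toContinuousLinearMap Ψ, fun v ↦ (α v).2,
    fun x ↦ by simp [Ψ], fun x hx ↦ ?_⟩
  have hπx : π x = ⟨x, hx⟩ := LinearMap.congr_fun hπ ⟨x, hx⟩
  simp [Ψ, hπx]

theorem ReflectsOver.isAlmostIsometricIdeal {Z : Submodule ℝ E} (hZ : ReflectsOver Z Z) :
    IsAlmostIsometricIdeal Z := by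
  intro ε hε F _
  obtain ⟨m, k, A, B, Ψ, hA, hAB, hΨ⟩ := exists_adapted_coordinates (Z.comap F.subtype)
  obtain ⟨C, hC, hΨC⟩ := Ψ.bound
  obtain ⟨D, hDZ, hBD⟩ := hZ m k (F.subtypeL ∘L A) (F.subtypeL ∘L B) hA (ε / C) (by positivity)
  have hx (x : F) : ((F.subtypeL ∘L A).coprod (F.subtypeL ∘L B)) (Ψ x) = x :=
    congrArg F.subtypeL (hAB x)
  let T : F →ₗ[ℝ] Z := LinearMap.codRestrict Z
    ((F.subtypeL ∘L A).coprod D ∘L Ψ).toLinearMap fun x ↦ Z.add_mem (hA _) (hDZ _)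
  have hT (x : F) : |‖x‖ - ‖T x‖| ≤ ε * ‖x‖ :=
    calc |‖x‖ - ‖T x‖| ≤ ε / C * ‖Ψ x‖ := by
          have h := hBD (Ψ x)
          rwa [hx] at h
      _ ≤ ε / C * (C * ‖x‖) := by gcongr; exact hΨC x
      _ = ε * ‖x‖ := by field_simp
  refine ⟨T, fun x hxZ ↦ ?_, fun x ↦ ?_⟩
  · calc ((T x : Z) : E) = (F.subtypeL ∘L A).coprod (F.subtypeL ∘L B) (Ψ x) := by
          simp [T, hΨ x hxZ]
      _ = x := hx x
  · have := abs_le.1 (hT x)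
    constructor <;> linarith

theorem exists_isSeparable_reflectsOver_self {A : Set E} (hA : IsSeparable A) :
    ∃ S : Submodule ℝ E, IsSeparable (S : Set E) ∧ A ⊆ S ∧ ReflectsOver S S := by
  choose! R hR_sep hR_le hR using fun S : Submodule ℝ E ↦ exists_isSeparable_reflectsOver (S := S)
  let S (n : ℕ) : Submodule ℝ E := R^[n] (Submodule.span ℝ A)
  have hS_succ (n : ℕ) : S (n + 1) = R (S n) := Function.iterate_succ_apply' R n _
  have hS_sep (n : ℕ) : IsSeparable (S n : Set E) := by
    induction n with
    | zero => exact hA.span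
    | succ n ih => exact hS_succ n ▸ hR_sep (S n) ih
  have hS_mono : Monotone S := monotone_nat_of_le_succ fun n ↦ hS_succ n ▸ hR_le (S n) (hS_sep n)
  refine ⟨⨆ n, S n, ?_, fun e he ↦ le_iSup S 0 (Submodule.subset_span he),
    reflectsOver_iSup hS_mono.directed_le fun n ↦ ⟨n + 1, hS_succ n ▸ hR (S n) (hS_sep n)⟩⟩
  rw [Submodule.coe_iSup_of_directed S hS_mono.directed_le]
  exact .iUnion hS_sep

theorem exists_separable_isAlmostIsometricIdeal {A : Set E} (hA : IsSeparable A) :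
    ∃ Z : Submodule ℝ E, A ⊆ Z ∧ IsClosed (Z : Set E) ∧ SeparableSpace Z ∧
      IsAlmostIsometricIdeal Z := by
  obtain ⟨S, hS_sep, hAS, hS⟩ := exists_isSeparable_reflectsOver_self hA
  refine ⟨S.topologicalClosure, hAS.trans S.le_topologicalClosure, S.isClosed_topologicalClosure,
    ?_, ?_⟩
  · exact (S.topologicalClosure_coe ▸ hS_sep.closure).separableSpace
  · exact (hS.topologicalClosure_right.mono_left S.le_topologicalClosure).isAlmostIsometricIdeal

end SeparableIdeals

theorem mainTheorem7_general (E : Type*) [NormedAddCommGroup E] [NormedSpace ℝ E]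
    (hE : ¬ NormAttainingEquivalence E) :
    ∃ Z : Submodule ℝ E, IsClosed (Z : Set E) ∧ TopologicalSpace.SeparableSpace Z ∧
      IsAlmostIsometricIdeal Z ∧ ¬ NormAttainingEquivalence Z := by
  obtain ⟨x, hx⟩ := not_forall.1 hE
  obtain ⟨hx_not, hδx⟩ : ¬ IsNormAttaining x ∧ IsNormAttaining (FreeBanachLattice.delta x) := by
    have := IsNormAttaining.delta (x := x)
    tauto
  obtain ⟨f, hf, hf₁, hfx⟩ := FreeBanachLattice.isNormAttaining_delta_iff.1 hδx
  obtain ⟨A, hA, hfA⟩ := FreeBanachLattice.exists_countable_mem_fblOn hf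
  obtain ⟨Z, hAZ, hZ_closed, hZ_sep, hZ⟩ := exists_separable_isAlmostIsometricIdeal hA.isSeparable
  obtain ⟨φ, hφ⟩ := hZ.exists_isHahnBanachExtensionOperator
  have hA_range : A ⊆ Set.range Z.subtypeₗᵢ := fun e he ↦ ⟨⟨e, hAZ he⟩, rfl⟩
  exact ⟨Z, hZ_closed, hZ_sep, hZ, fun hZ_equiv ↦ hx_not <| hφ.isNormAttaining_of_mem_fblOn
    hZ_equiv (FreeBanachLattice.fblOn_mono hA_range hfA) hf₁ hfx⟩

theorem mainTheorem7 (E : Type u) [NormedAddCommGroup E] [NormedSpace ℝ E]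
    [CompleteSpace E] :
    (¬ NormAttainingEquivalence E →
      ∃ Z : Submodule ℝ E, IsClosed (Z : Set E) ∧ TopologicalSpace.SeparableSpace Z ∧
        IsAlmostIsometricIdeal Z ∧ ¬ NormAttainingEquivalence Z) ∧
    ((∀ (F : Type u) [NormedAddCommGroup F] [NormedSpace ℝ F] [CompleteSpace F]
        [TopologicalSpace.SeparableSpace F], NormAttainingEquivalence F) →
      NormAttainingEquivalence E) := by
  refine ⟨mainTheorem7_general E, fun h ↦ by_contra fun hE ↦ ?_⟩
  obtain ⟨Z, hZ_closed, _, -, hZ⟩ := mainTheorem7_general E hE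
  have := hZ_closed.completeSpace_coe
  exact hZ (h Z)
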